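/- **Consistency of federated meta-learning of kernels (F-Meta-KGL).** *Setting.* Let $\phi_j:\mathcal X\to\mathbb R^{d_j}$, $j=1,\dots,p$, be feature maps with kernels $k_j(x,x')=\phi_j(x)^\top\phi_j(x')\le 1$, and write $b=(b^{(1)},\dots,b^{(p)})$, $b^{(j)}\in\mathbb R^{d_j}$, for coefficient vectors. Let $J^\star\subseteq\{1,\dots,p\}$. There are $m$ clients; client $s$ observes $y_{s,i}=\sum_{j}\phi_j(x_{s,i})^\top\beta_s^{\star(j)}+\varepsilon_{s,i}$, $i=1,\dots,n_s$, at fixed design points $x_{s,i}$, where $\beta_s^{\star(j)}=0$ for $j\notin J^\star$ and the noise variables $\varepsilon_{s,i}$ are independent and sub-Gaussian with variance proxy $\sigma^2>0$, i.e. $\mathbb E\,e^{t\varepsilon_{s,i}}\le e^{\sigma^2t^2/2}$ for all $t\in\mathbb R$. Let $\Phi_s$ be the $n_s\times\sum_j d_j$ feature matrix of client $s$, and $\Phi_s^{(j)}$ its $j$-th block of columns. Client $s$ computes some minimizer $\hat\beta_s$ of $$\frac1{n_s}\|y_s-\Phi_s\beta\|_2^2+\lambda\sum_{j=1}^p\|\beta^{(j)}\|_2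 .$$ For a threshold $\omega$ and a level $\alpha\in(0,1)$ the server outputs $$\hat J_{\mathrm f}=\Big\{j:\ \big|\{s\le m:\ \|\hat\beta_s^{(j)}\|_2>\omega\}\big|>m\alpha\Big\}.$$ *Assumptions.* (Beta-min) $\|\beta_s^{\star(j)}\|_2\ge c_{1,\mathrm f}$ for all $s\le m$, $j\in J^\star$, with $c_{1,\mathrm f}>0$. (Compatibility) $\kappa(\Phi_s)\ge c_\kappa>0$ for all $s\le m$, where $\kappa(\Phi_s)$ is the infimum of $\frac{1}{\sqrt{n_s}}\|\Phi_sb\|_2/\sum_{j\in J}\|b^{(j)}\|_2$ over $b\ne0$ and $|J|\le|J^\star|$ with $\sum_{j\notin J}\|b^{(j)}\|_2\le3\sum_{j\in J}\|b^{(j)}\|_2$. Let $\omega\in(0,c_{1,\mathrm f})$ and $\bar\omega=\min\{\omega,c_{1,\mathrm f}-\omega\}$. *Theorem.* 1. (Quantitative form.) Let $\lambda\le\bar\omega c_\kappa^2/8$ and suppose that $\frac{\lambda n_s}{4\sigma}>\sqrt{\operatorname{tr}(\Phi_s^{(j)}\Phi_s^{(j)\top})}$ for all $s\le m$, $j\le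 p$. Put $$v_s=1-p\max_{j\le p}\exp\!\Big(-\tfrac{\big(\frac{\lambda n_s}{4\sigma}-\sqrt{\operatorname{tr}(\Phi_s^{(j)}\Phi_s^{(j)\top})}\big)^2}{2\|\Phi_s^{(j)}\Phi_s^{(j)\top}\|_2}\Big),\qquad v=\frac1m\sum_{s=1}^mv_s,\qquad a=\max\{\alpha,1-\alpha\}$$ (the exponential is read as $0$ if $\Phi_s^{(j)}=0$). If $v>a$, then $$\mathbb P[\hat J_{\mathrm f}=J^\star]\ \ge\ 1-\exp\!\Big(-m\Big(a\log\tfrac{a}{v}+(1-a)\log\tfrac{1-a}{1-v}\Big)\Big)$$ and $$\mathbb P[\hat J_{\mathrm f}=J^\star]\ \ge\ 1-\exp\!\Big(-m\,\tfrac{(v-a)^2}{2a(1-a)}\Big).$$ 2. (Consistency in the sample size.) Let $n_s=\underline n$ for all $s$ and $\lambda=\bar\omega c_\kappa^2/8$. For every fixed $m\ge1$, and for arbitrary sequences (indexed by $\underline n$) of such federated problems that satisfy the assumptions for all large $\underline n$ with the same $\phi_j,J^\star,\sigma,c_{1,\mathrm f},c_\kappa,\omega,\alpha$, one has $\lim_{\underline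 n\to\infty}\mathbb P[\hat J_{\mathrm f}=J^\star]=1$. 3. (Consistency in the number of clients.) Let $n_s=\underline n\ge1$ for all $s$, $\lambda=\bar\omega c_\kappa^2/8$, and let $\underline n$ be so large that $$\bar\omega>\Big(\sqrt{2\log\big(p/\min\{\alpha,1-\alpha\}\big)}+1\Big)\frac{32\,\sigma}{\sqrt{\underline n}\,c_\kappa^2}.$$ For arbitrary sequences (indexed by $m$) of such federated problems that satisfy the assumptions for all large $m$ with the same $\phi_j,J^\star,\sigma,c_{1,\mathrm f},c_\kappa,\omega,\alpha$, one has $\lim_{m\to\infty}\mathbb P[\hat J_{\mathrm f}=J^\star]=1$. -/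

import Mathlib

open MeasureTheory ProbabilityTheory Filter Topology
open scoped NNReal ENNReal

noncomputable section

namespace FedKGL

/-- Coefficient vectors, split into `p` groups: `b j` is the block of group `j`, an element of
Euclidean space of dimension `d j`. -/
abbrev Coef {p : ℕ} (d : Fin p → ℕ) : Type := (j : Fin p) → EuclideanSpace ℝ (Fin (d j))

/-- A family of finite-dimensional feature maps, one for each of the `p` base kernels. -/
abbrev FeatureMaps (𝒳 : Type*) {p : ℕ} (d : Fin p → ℕ) : Type _ :=
  (j : Fin p) → 𝒳 → EuclideanSpace ℝ (Fin (d j))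

variable {𝒳 : Type*} {p : ℕ} {d : Fin p → ℕ}

/-- The base kernel `k_j(x, x') = φ_j(x)ᵀ φ_j(x')`. -/
def baseKernel (φ : FeatureMaps 𝒳 d) (j : Fin p) (x x' : 𝒳) : ℝ := inner ℝ (φ j x) (φ j x')

/-- The function `x ↦ ∑ j, φ_j(x)ᵀ b_j` with coefficients `b`. -/
def linFun (φ : FeatureMaps 𝒳 d) (b : Coef d) (x : 𝒳) : ℝ := ∑ j, inner ℝ (φ j x) (b j)

/-- The local loss `(1/n) ‖y - Φ b‖² + lam ∑ j, ‖b j‖` of a client with data `(x, y)`. -/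
def groupLassoLoss (φ : FeatureMaps 𝒳 d) (lam : ℝ) {n : ℕ} (x : Fin n → 𝒳) (y : Fin n → ℝ)
    (b : Coef d) : ℝ :=
  (1 / (n : ℝ)) * ∑ i, (y i - linFun φ b (x i)) ^ 2 + lam * ∑ j, ‖b j‖

/-- `b` is a global minimizer of the local loss. -/
def IsGroupLassoSolution (φ : FeatureMaps 𝒳 d) (lam : ℝ) {n : ℕ} (x : Fin n → 𝒳)
    (y : Fin n → ℝ) (b : Coef d) : Prop :=
  ∀ b' : Coef d, groupLassoLoss φ lam x y b ≤ groupLassoLoss φ lam x y b'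

/-- The compatibility constant `κ(Φ)` of the design `x` at sparsity level `k`: the infimum of
`‖Φ b‖ / (√n ∑_{j ∈ J} ‖b j‖)` over `b ≠ 0` and `|J| ≤ k` with
`∑_{j ∉ J} ‖b j‖ ≤ 3 ∑_{j ∈ J} ‖b j‖` (the infimum of the empty set is `∞`). -/
def compatConst (φ : FeatureMaps 𝒳 d) (k : ℕ) {n : ℕ} (x : Fin n → 𝒳) : ℝ≥0∞ :=
  ⨅ (J : Finset (Fin p)) (b : Coef d) (_ : J.card ≤ k) (_ : b ≠ 0)
    (_ : ∑ j ∈ Jᶜ, ‖b j‖ ≤ 3 * ∑ j ∈ J, ‖b j‖),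
    ENNReal.ofReal ((1 / √(n : ℝ)) * (√(∑ i, linFun φ b (x i) ^ 2) / ∑ j ∈ J, ‖b j‖))

/-- The `n × d_j` feature matrix of group `j`. -/
def groupDesign (φ : FeatureMaps 𝒳 d) {n : ℕ} (x : Fin n → 𝒳) (j : Fin p) :
    Matrix (Fin n) (Fin (d j)) ℝ :=
  Matrix.of fun i l => φ j (x i) l

/-- The matrix `Φ^{(j)} (Φ^{(j)})ᵀ`. -/
def groupGram (φ : FeatureMaps 𝒳 d) {n : ℕ} (x : Fin n → 𝒳) (j : Fin p) :
    Matrix (Fin n) (Fin n) ℝ :=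
  groupDesign φ x j * (groupDesign φ x j).transpose

/-- `exp (-(lam n / (4 σ) - √tr G)² / (2 ‖G‖₂))` with `G = Φ^{(j)} (Φ^{(j)})ᵀ` and the spectral
norm `‖G‖₂`; it is read as its limit `0` if `G = 0`. -/
def groupFailure (φ : FeatureMaps 𝒳 d) (lam σ : ℝ) {n : ℕ} (x : Fin n → 𝒳) (j : Fin p) : ℝ :=
  open Classical in
  if groupGram φ x j = 0 then 0 else
    Real.exp (-(lam * n / (4 * σ) - √(groupGram φ x j).trace) ^ 2 /
      (2 * ‖Matrix.toEuclideanCLM (𝕜 := ℝ) (n := Fin n) (groupGram φ x j)‖))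

/-- The success level `v_s = 1 - p max_j exp (…)` of a single client. -/
def clientLevel (φ : FeatureMaps 𝒳 d) (lam σ : ℝ) {n : ℕ} (x : Fin n → 𝒳) : ℝ :=
  1 - p * ⨆ j : Fin p, groupFailure φ lam σ x j

/-- The support estimate of one client: the groups with norm above the threshold. -/
def clientSupport (thr : ℝ) (b : Coef d) : Finset (Fin p) :=
  Finset.univ.filter fun j => thr < ‖b j‖

/-- The `α`-majority vote of `m` clients: the groups selected by more than `m α` of them. -/
def majorityVote {m : ℕ} (α : ℝ) (S : Fin m → Finset (Fin p)) : Finset (Fin p) :=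
  Finset.univ.filter fun j => (m : ℝ) * α < ((Finset.univ.filter fun s => j ∈ S s).card : ℝ)

/-- The relative entropy of the Bernoulli laws with parameters `a` and `v`. -/
def bernoulliKL (a v : ℝ) : ℝ :=
  a * Real.log (a / v) + (1 - a) * Real.log ((1 - a) / (1 - v))

/-- The data of a federated regression with `m` clients, the `s`-th of which holds `n s` samples:
the design points, the true coefficients, the noise, and the coefficients that each client
computes from its data. -/
structure Experiment (𝒳 Ω : Type*) {p : ℕ} (d : Fin p → ℕ) (m : ℕ) (n : Fin m → ℕ) where
  x : (s : Fin m) → Fin (n s) → 𝒳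
  betaStar : Fin m → Coef d
  ε : (s : Fin m) → Fin (n s) → Ω → ℝ
  betaHat : Fin m → Ω → Coef d

namespace Experiment

variable {Ω : Type*} {m : ℕ} {n : Fin m → ℕ}

/-- The observations `y_{s,i} = f_s(x_{s,i}) + ε_{s,i}` of client `s`. -/
def y (E : Experiment 𝒳 Ω d m n) (φ : FeatureMaps 𝒳 d) (s : Fin m) (w : Ω) : Fin (n s) → ℝ :=
  fun i => linFun φ (E.betaStar s) (E.x s i) + E.ε s i w

/-- The federated support estimate. -/
def Jhat (E : Experiment 𝒳 Ω d m n) (thr α : ℝ) (w : Ω) : Finset (Fin p) :=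
  majorityVote α fun s => clientSupport thr (E.betaHat s w)

/-- The standing assumptions: the noise variables are independent and sub-Gaussian with variance
proxy `σ²`; the coefficients are supported on `Jstar` and satisfy the per-task beta-min condition
with constant `c₁`; every client's design has compatibility constant at least `cκ`; and every
client computes some minimizer of its local loss with regularization parameter `lam`. -/
structure Assumptions [MeasurableSpace Ω] (E : Experiment 𝒳 Ω d m n) (μ : Measure Ω)
    (φ : FeatureMaps 𝒳 d) (Jstar : Finset (Fin p)) (σ : ℝ≥0) (c₁ cκ lam : ℝ) : Prop where
  noise_measurable : ∀ s i, Measurable (E.ε s i)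
  noise_indep : iIndepFun (fun q : (s : Fin m) × Fin (n s) => E.ε q.1 q.2) μ
  noise_subgaussian : ∀ s i, HasSubgaussianMGF (E.ε s i) (σ ^ 2) μ
  sparse : ∀ s, ∀ j, j ∉ Jstar → E.betaStar s j = 0
  beta_min : ∀ s, ∀ j ∈ Jstar, c₁ ≤ ‖E.betaStar s j‖
  compatible : ∀ s, ENNReal.ofReal cκ ≤ compatConst φ Jstar.card (E.x s)
  solution : ∀ s w, IsGroupLassoSolution φ lam (E.x s) (E.y φ s w) (E.betaHat s w)

end Experiment

end FedKGL

end

/-! ### Quadratic forms of sub-Gaussian vectors -/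

/-! Everything reduces to one event per client, `noiseEvent`: every block of `Φᵀε` has norm at most
`lam * n / 4`. On it the argument is deterministic. The noise term costs at most half the penalty,
so the error of the minimizer lies in the cone of the compatibility condition and each block is off
by at most `9/2 * lam / cκ²`. As `lam ≤ thrBar * cκ² / 8`, this is below `thrBar`, and thresholding
returns exactly `Jstar` (`clientSupport_eq`). If more than `m * max α (1 - α)` clients are correct,
so is the vote (`majorityVote_eq`).

The probability of the event comes from a tail bound for `‖Φᵀε‖²`, a quadratic form in the noise
with Gram matrix `G` (`measure_quadraticForm_ge_le`). The exponential of the square is written as an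
average over an independent Gaussian vector, which leaves only linear forms in `ε`; Markov's
inequality with an optimized exponent follows. A union bound over groups gives `clientLevel`.

The events of different clients are independent with unequal probabilities. The Chernoff bound needs
only their average (AM-GM), which gives the relative entropy bound, and `sq_div_le_bernoulliKL`
gives the quadratic one.

For growing `n` with fixed `m`, a union bound makes all clients succeed at once. For growing `m`,
the trace and spectral norm of `G` are at most `n`, so the clients share a success level `v > a`
independent of `m`, and the bound decays exponentially. -/

theorem lintegral_exp_mul_gaussianReal (t : ℝ) :
    ∫⁻ g, ENNReal.ofReal (Real.exp (t * g)) ∂(gaussianReal 0 1) =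
      ENNReal.ofReal (Real.exp (t ^ 2 / 2)) := by
  have h := congrFun (mgf_fun_id_gaussianReal (μ := 0) (v := 1)) t
  rw [← ofReal_integral_eq_lintegral_ofReal (integrable_exp_mul_gaussianReal t)
    (ae_of_all _ fun _ => (Real.exp_pos _).le)]
  simp only [mgf] at h
  rw [h]
  simp

/-- Square root of `1 + y ≤ exp y` at `y = x / (1 - x)`, where `1 + y = (1 - x)⁻¹`. -/
theorem one_div_sqrt_one_sub_le {x : ℝ} (hx : x < 1) :
    (√(1 - x))⁻¹ ≤ Real.exp (x / (2 * (1 - x))) := by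
  have h1 : 0 < 1 - x := by linarith
  have h2 : (1 - x)⁻¹ ≤ Real.exp (x / (1 - x)) := by
    have := Real.add_one_le_exp (x / (1 - x))
    have h3 : x / (1 - x) + 1 = (1 - x)⁻¹ := by field_simp; ring
    linarith
  rw [← Real.sqrt_inv]
  refine Real.sqrt_le_iff.2 ⟨(Real.exp_pos _).le, h2.trans (le_of_eq ?_)⟩
  rw [← Real.exp_nat_mul]
  congr 1
  push_cast
  field_simp

/-- The Gaussian integral equals `(1 - 2c)^(-1/2)` exactly; the exponential form is looser but turns
products over coordinates into sums. -/
theorem lintegral_exp_mul_sq_gaussianReal_le {c : ℝ} (hc : 2 * c < 1) :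
    ∫⁻ g, ENNReal.ofReal (Real.exp (c * g ^ 2)) ∂(gaussianReal 0 1) ≤
      ENNReal.ofReal (Real.exp (c / (1 - 2 * c))) := by
  have hb : 0 < 1 / 2 - c := by linarith
  rw [gaussianReal_of_var_ne_zero _ one_ne_zero,
    lintegral_withDensity_eq_lintegral_mul _ (measurable_gaussianPDF _ _) (by fun_prop)]
  have h : ∀ g : ℝ, (gaussianPDF 0 1 * fun g => ENNReal.ofReal (Real.exp (c * g ^ 2))) g =
      ENNReal.ofReal ((√(2 * Real.pi))⁻¹ * Real.exp (-(1 / 2 - c) * g ^ 2)) := by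
    intro g
    rw [Pi.mul_apply, gaussianPDF_def, ← ENNReal.ofReal_mul (gaussianPDFReal_nonneg _ _ _),
      gaussianPDFReal_def]
    simp only [NNReal.coe_one, mul_one, sub_zero]
    rw [mul_assoc, ← Real.exp_add]
    congr 3
    ring
  rw [lintegral_congr h, ← ofReal_integral_eq_lintegral_ofReal
    ((integrable_exp_neg_mul_sq hb).const_mul _) (ae_of_all _ fun _ => by positivity),
    integral_const_mul, integral_gaussian]
  refine ENNReal.ofReal_le_ofReal ?_
  have h1 := one_div_sqrt_one_sub_le hc
  have h2 : Real.pi / (1 / 2 - c) = (2 * Real.pi) * (1 - 2 * c)⁻¹ := by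
    field_simp
  have h3 : √(2 * Real.pi) ≠ 0 := by positivity
  rw [h2, Real.sqrt_mul (x := 2 * Real.pi) (by positivity), inv_mul_cancel_left₀ h3,
    Real.sqrt_inv]
  convert h1 using 2
  have : 1 - 2 * c ≠ 0 := by linarith
  field_simp

theorem lintegral_prod_eval_pi {ι : Type*} [Fintype ι] (ν : Measure ℝ) [IsProbabilityMeasure ν]
    (f : ι → ℝ → ℝ≥0∞) (hf : ∀ i, Measurable (f i)) :
    ∫⁻ g, ∏ i, f i (g i) ∂(Measure.pi fun _ : ι => ν) = ∏ i, ∫⁻ x, f i x ∂ν := by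
  rw [lintegral_prod_eq_prod_lintegral_of_indepFun Finset.univ (fun i (g : ι → ℝ) => f i (g i))
    (iIndepFun_pi fun i => (hf i).aemeasurable) (fun i => (hf i).comp (measurable_pi_apply i))]
  refine Finset.prod_congr rfl fun i _ => ?_
  exact (measurePreserving_eval (fun _ : ι => ν) i).lintegral_comp (hf i)

/-- Decoupling of a diagonal quadratic form with an independent standard Gaussian vector. -/
theorem lintegral_exp_sum_mul_sq_le {Ω ι : Type*} [Fintype ι] [MeasurableSpace Ω] {μ : Measure Ω}
    [SFinite μ] {Z : ι → Ω → ℝ} (hZ : ∀ i, Measurable (Z i)) {τ : ℝ}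
    (hsub : ∀ t : ι → ℝ, ∫⁻ w, ENNReal.ofReal (Real.exp (∑ i, t i * Z i w)) ∂μ ≤
      ENNReal.ofReal (Real.exp (τ * (∑ i, t i ^ 2) / 2)))
    {c : ι → ℝ} (hc : ∀ i, 0 ≤ c i) (hc' : ∀ i, 2 * (τ * c i) < 1) :
    ∫⁻ w, ENNReal.ofReal (Real.exp (∑ i, c i * Z i w ^ 2)) ∂μ ≤
      ENNReal.ofReal (Real.exp (∑ i, τ * c i / (1 - 2 * (τ * c i)))) := by
  set γ : Measure (ι → ℝ) := Measure.pi fun _ : ι => gaussianReal 0 1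
  -- Since `E exp (t g) = exp (t² / 2)`, the choice `t = √(2 c i) * Z i w` linearizes the square.
  have h1 : ∀ w, ENNReal.ofReal (Real.exp (∑ i, c i * Z i w ^ 2)) =
      ∫⁻ g, ENNReal.ofReal (Real.exp (∑ i, √(2 * c i) * g i * Z i w)) ∂γ := by
    intro w
    have : ∀ g : ι → ℝ, ENNReal.ofReal (Real.exp (∑ i, √(2 * c i) * g i * Z i w)) =
        ∏ i, ENNReal.ofReal (Real.exp (√(2 * c i) * Z i w * g i)) := by
      intro g
      rw [Real.exp_sum, ENNReal.ofReal_prod_of_nonneg fun _ _ => (Real.exp_pos _).le]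
      exact Finset.prod_congr rfl fun i _ => by rw [mul_right_comm]
    rw [lintegral_congr this, lintegral_prod_eval_pi _
      (fun i x => ENNReal.ofReal (Real.exp (√(2 * c i) * Z i w * x))) (fun i => by fun_prop),
      Real.exp_sum, ENNReal.ofReal_prod_of_nonneg fun _ _ => (Real.exp_pos _).le]
    refine Finset.prod_congr rfl fun i _ => ?_
    rw [lintegral_exp_mul_gaussianReal, mul_pow, Real.sq_sqrt (by linarith [hc i])]
    congr 2
    ring
  rw [lintegral_congr h1, lintegral_lintegral_swap (by fun_prop)]
  -- After Tonelli, `g` is frozen and the sub-Gaussian hypothesis applies to a linear form in `Z`; a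
  -- quadratic form in the Gaussian `g` remains.
  have h2 : ∀ g : ι → ℝ, ∫⁻ w, ENNReal.ofReal (Real.exp (∑ i, √(2 * c i) * g i * Z i w)) ∂μ ≤
      ∏ i, ENNReal.ofReal (Real.exp (τ * c i * g i ^ 2)) := by
    intro g
    refine (hsub _).trans (le_of_eq ?_)
    rw [← ENNReal.ofReal_prod_of_nonneg fun _ _ => (Real.exp_pos _).le, ← Real.exp_sum,
      Finset.mul_sum, Finset.sum_div]
    congr 2
    refine Finset.sum_congr rfl fun i _ => ?_
    rw [mul_pow, Real.sq_sqrt (by linarith [hc i])]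
    ring
  refine (lintegral_mono h2).trans ?_
  rw [lintegral_prod_eval_pi _ (fun i x => ENNReal.ofReal (Real.exp (τ * c i * x ^ 2)))
    (fun i => by fun_prop), Real.exp_sum,
    ENNReal.ofReal_prod_of_nonneg fun _ _ => (Real.exp_pos _).le]
  exact Finset.prod_le_prod' fun i _ => lintegral_exp_mul_sq_gaussianReal_le (hc' i)

theorem toEuclideanCLM_eigenvectorBasis {ι : Type*} [Fintype ι] [DecidableEq ι] {G : Matrix ι ι ℝ}
    (hG : G.IsHermitian) (k : ι) :
    Matrix.toEuclideanCLM (𝕜 := ℝ) G (hG.eigenvectorBasis k) =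
      hG.eigenvalues k • hG.eigenvectorBasis k := by
  ext i
  exact congrFun (hG.mulVec_eigenvectorBasis k) i

theorem dotProduct_mulVec_eq_sum_eigenvalues {ι : Type*} [Fintype ι] [DecidableEq ι] {G : Matrix ι ι ℝ}
    (hG : G.IsHermitian) (e : EuclideanSpace ℝ ι) :
    e.ofLp ⬝ᵥ G.mulVec e.ofLp =
      ∑ k, hG.eigenvalues k * inner ℝ (hG.eigenvectorBasis k) e ^ 2 := by
  have hsymm := Matrix.isSymmetric_toEuclideanLin_iff.mpr hG
  rw [← Matrix.inner_toEuclideanCLM, ← hG.eigenvectorBasis.sum_inner_mul_inner]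
  refine Finset.sum_congr rfl fun k _ => ?_
  have h1 : inner ℝ (hG.eigenvectorBasis k) (Matrix.toEuclideanCLM (𝕜 := ℝ) G e) =
      inner ℝ (Matrix.toEuclideanCLM (𝕜 := ℝ) G (hG.eigenvectorBasis k)) e :=
    (hsymm (hG.eigenvectorBasis k) e).symm
  have h2 := toEuclideanCLM_eigenvectorBasis hG k
  rw [h1, h2, inner_smul_left, real_inner_comm]
  simp only [conj_trivial]
  ring

theorem eigenvalues_le_norm_toEuclideanCLM {ι : Type*} [Fintype ι] [DecidableEq ι]
    {G : Matrix ι ι ℝ} (hG : G.IsHermitian) (k : ι) :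
    hG.eigenvalues k ≤ ‖Matrix.toEuclideanCLM (𝕜 := ℝ) G‖ := by
  have h2 := toEuclideanCLM_eigenvectorBasis hG k
  have h := (Matrix.toEuclideanCLM (𝕜 := ℝ) G).le_opNorm (hG.eigenvectorBasis k)
  rw [h2, norm_smul, hG.eigenvectorBasis.norm_eq_one, mul_one, mul_one] at h
  exact (le_abs_self _).trans h

/-- The tail bound for quadratic forms of sub-Gaussian vectors. -/
theorem measure_quadraticForm_ge_le {Ω ι : Type*} [Fintype ι] [DecidableEq ι] [MeasurableSpace Ω]
    {μ : Measure Ω} [SFinite μ] {e : Ω → EuclideanSpace ℝ ι} (he : Measurable e) {σ : ℝ}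
    (hσ : 0 < σ)
    (hsub : ∀ u, ∫⁻ w, ENNReal.ofReal (Real.exp (inner ℝ u (e w))) ∂μ ≤
      ENNReal.ofReal (Real.exp (σ ^ 2 * ‖u‖ ^ 2 / 2)))
    {G : Matrix ι ι ℝ} (hG : G.PosSemidef) (hG0 : G ≠ 0) {R : ℝ} (hR : √G.trace < R) :
    μ {w | (σ * R) ^ 2 ≤ (e w).ofLp ⬝ᵥ G.mulVec (e w).ofLp} ≤
      ENNReal.ofReal (Real.exp (-(R - √G.trace) ^ 2 /
        (2 * ‖Matrix.toEuclideanCLM (𝕜 := ℝ) G‖))) := by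
  have hH := hG.isHermitian
  set L := ‖Matrix.toEuclideanCLM (𝕜 := ℝ) G‖ with hL
  set T := G.trace with hT
  have hL0 : 0 < L := by
    rw [hL, norm_pos_iff]
    simpa using hG0
  have hT0 : 0 < T := lt_of_le_of_ne hG.trace_nonneg fun h => hG0 (hG.trace_eq_zero_iff.1 h.symm)
  have hs0 : 0 < √T := Real.sqrt_pos.2 hT0
  have hR0 : 0 < R := hs0.trans hR
  -- With `η = θ / (2 σ² L)`, Markov leaves the exponent `(θ T / (1 - θ) - θ R²) / (2 L)`. Its
  -- minimum over `θ` is at `1 - θ = √T / R`, with value `-(R - √T)² / (2 L)`.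
  set θ := 1 - √T / R with hθ
  have hθ0 : 0 < θ := by
    rw [hθ, sub_pos, div_lt_one hR0]; exact hR
  have hθ1 : 0 < 1 - θ := by
    rw [hθ, sub_sub_cancel]; positivity
  set η := θ / (2 * σ ^ 2 * L) with hη
  have hη0 : 0 < η := by positivity
  have hl0 := hG.eigenvalues_nonneg
  have hlL := eigenvalues_le_norm_toEuclideanCLM hH
  have hx : ∀ k, σ ^ 2 * (η * hH.eigenvalues k) = θ * hH.eigenvalues k / (2 * L) := by
    intro k; rw [hη]; field_simp
  have hx2 : ∀ k, 2 * (σ ^ 2 * (η * hH.eigenvalues k)) ≤ θ := by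
    intro k
    rw [hx, mul_div_assoc', mul_div_mul_left _ _ two_ne_zero, div_le_iff₀ hL0]
    exact mul_le_mul_of_nonneg_left (hlL k) hθ0.le
  -- The coordinates in an eigenbasis of `G` need not be independent, but their linear forms keep
  -- the same sub-Gaussian bound, which is all that decoupling uses.
  have key := lintegral_exp_sum_mul_sq_le (μ := μ) (τ := σ ^ 2)
    (Z := fun k w => inner ℝ (hH.eigenvectorBasis k) (e w)) (fun k => by fun_prop)
    (fun t => by
      have h := hsub (∑ k, t k • hH.eigenvectorBasis k)
      have h1 : ‖∑ k, t k • hH.eigenvectorBasis k‖ ^ 2 = ∑ k, t k ^ 2 := by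
        rw [← real_inner_self_eq_norm_sq, hH.eigenvectorBasis.orthonormal.inner_sum]
        simp [pow_two]
      rw [h1] at h
      simpa [sum_inner, inner_smul_left] using h)
    (c := fun k => η * hH.eigenvalues k) (fun k => mul_nonneg hη0.le (hl0 k))
    (fun k => (hx2 k).trans_lt (by linarith))
  have hquad : ∀ w, ∑ k, η * hH.eigenvalues k * inner ℝ (hH.eigenvectorBasis k) (e w) ^ 2 =
      η * ((e w).ofLp ⬝ᵥ G.mulVec (e w).ofLp) := by
    intro w
    rw [dotProduct_mulVec_eq_sum_eigenvalues hH, Finset.mul_sum]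
    exact Finset.sum_congr rfl fun k _ => mul_assoc _ _ _
  simp only [hquad] at key
  have hmono : ∑ k, σ ^ 2 * (η * hH.eigenvalues k) /
      (1 - 2 * (σ ^ 2 * (η * hH.eigenvalues k))) ≤ θ * T / (2 * L) / (1 - θ) := by
    have hTs : T = ∑ k, hH.eigenvalues k := by
      simpa using hH.trace_eq_sum_eigenvalues
    rw [hTs, Finset.mul_sum, Finset.sum_div, Finset.sum_div]
    refine Finset.sum_le_sum fun k _ => ?_
    rw [← hx]
    exact div_le_div_of_nonneg_left (by have := hl0 k; positivity) hθ1 (by linarith [hx2 k])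
  have hsubset : {w | (σ * R) ^ 2 ≤ (e w).ofLp ⬝ᵥ G.mulVec (e w).ofLp} ⊆
      {w | ENNReal.ofReal (Real.exp (η * (σ * R) ^ 2)) ≤
        ENNReal.ofReal (Real.exp (η * ((e w).ofLp ⬝ᵥ G.mulVec (e w).ofLp)))} := by
    intro w hw
    exact ENNReal.ofReal_le_ofReal (Real.exp_le_exp.2 (mul_le_mul_of_nonneg_left hw hη0.le))
  refine (measure_mono hsubset).trans ?_
  refine (meas_ge_le_lintegral_div ?_ (by simp [Real.exp_pos]) ENNReal.ofReal_ne_top).trans ?_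
  · simp only [← hquad]
    fun_prop
  refine (ENNReal.div_le_div_right (key.trans
    (ENNReal.ofReal_le_ofReal (Real.exp_le_exp.2 hmono))) _).trans (le_of_eq ?_)
  rw [← ENNReal.ofReal_div_of_pos (Real.exp_pos _), ← Real.exp_sub]
  congr 2
  have hTs : T = √T ^ 2 := (Real.sq_sqrt hT0.le).symm
  have h1θ : 1 - θ = √T / R := by rw [hθ]; ring
  rw [h1θ, hη, hθ]
  nth_rewrite 2 [hTs]
  field_simp
  ring

theorem lintegral_exp_inner_le_of_iIndepFun {Ω : Type*} [MeasurableSpace Ω] {μ : Measure Ω}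
    {ι : Type*} [Fintype ι] {ε : ι → Ω → ℝ} (hind : iIndepFun ε μ) {c : ℝ≥0}
    (hsub : ∀ i, HasSubgaussianMGF (ε i) c μ) (u : EuclideanSpace ℝ ι) :
    ∫⁻ w, ENNReal.ofReal (Real.exp (inner ℝ u (WithLp.toLp 2 fun i => ε i w))) ∂μ ≤
      ENNReal.ofReal (Real.exp (c * ‖u‖ ^ 2 / 2)) := by
  have h := HasSubgaussianMGF.sum_of_iIndepFun (s := Finset.univ)
    (hind.comp (fun i (x : ℝ) => u i * x) (fun i => by fun_prop))
    (fun i _ => (hsub i).const_mul (u i))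
  have h1 := h.mgf_le 1
  have h2 := h.integrable_exp_mul 1
  simp only [mgf, one_mul, one_pow, mul_one, Function.comp_apply] at h1 h2
  have h3 : ∀ w, inner ℝ u (WithLp.toLp 2 fun i => ε i w) = ∑ i, u i * ε i w := by
    intro w
    simp [PiLp.inner_apply, mul_comm]
  simp only [h3]
  rw [← ofReal_integral_eq_lintegral_ofReal h2 (ae_of_all _ fun _ => (Real.exp_pos _).le)]
  refine ENNReal.ofReal_le_ofReal (h1.trans (le_of_eq ?_))
  rw [EuclideanSpace.real_norm_sq_eq]
  congr 2
  push_cast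
  rw [Finset.mul_sum]
  exact Finset.sum_congr rfl fun i _ => mul_comm _ _

/-- In an eigenbasis each eigenvalue is at most the sum of all of them, as none is negative. -/
theorem norm_toEuclideanCLM_le_trace {ι : Type*} [Fintype ι] [DecidableEq ι]
    {G : Matrix ι ι ℝ} (hG : G.PosSemidef) :
    ‖Matrix.toEuclideanCLM (𝕜 := ℝ) G‖ ≤ G.trace := by
  have hH := hG.isHermitian
  have hsymm := Matrix.isSymmetric_toEuclideanLin_iff.mpr hH
  have hl0 := hG.eigenvalues_nonneg
  have hT : G.trace = ∑ k, hH.eigenvalues k := by simpa using hH.trace_eq_sum_eigenvalues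
  refine ContinuousLinearMap.opNorm_le_bound _ hG.trace_nonneg fun e => ?_
  refine le_of_sq_le_sq ?_ (mul_nonneg hG.trace_nonneg (norm_nonneg _))
  rw [mul_pow, ← hH.eigenvectorBasis.sum_sq_norm_inner_right e,
    ← hH.eigenvectorBasis.sum_sq_norm_inner_right, Finset.mul_sum]
  refine Finset.sum_le_sum fun k _ => ?_
  have h1 : inner ℝ (hH.eigenvectorBasis k) (Matrix.toEuclideanCLM (𝕜 := ℝ) G e) =
      inner ℝ (Matrix.toEuclideanCLM (𝕜 := ℝ) G (hH.eigenvectorBasis k)) e :=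
    (hsymm (hH.eigenvectorBasis k) e).symm
  have h2 := toEuclideanCLM_eigenvectorBasis hH k
  have h3 : hH.eigenvalues k ≤ G.trace :=
    hT ▸ Finset.single_le_sum (fun j _ => hl0 j) (Finset.mem_univ k)
  rw [h1, h2, inner_smul_left, norm_mul, mul_pow]
  refine mul_le_mul_of_nonneg_right ?_ (sq_nonneg _)
  simpa [abs_of_nonneg (hl0 k)] using pow_le_pow_left₀ (hl0 k) h3 2

/-! ### Estimation error of the group lasso -/

namespace FedKGL

variable {𝒳 : Type*} {p : ℕ} {d : Fin p → ℕ}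

theorem linFun_sub (φ : FeatureMaps 𝒳 d) (b b' : Coef d) (x : 𝒳) :
    linFun φ (b - b') x = linFun φ b x - linFun φ b' x := by
  simp [linFun, inner_sub_right, Finset.sum_sub_distrib]

theorem sum_mul_linFun_le (φ : FeatureMaps 𝒳 d) {n : ℕ} (x : Fin n → 𝒳) (e : Fin n → ℝ)
    (b : Coef d) {r : ℝ} (hr : ∀ j, ‖∑ i, e i • φ j (x i)‖ ≤ r) :
    ∑ i, e i * linFun φ b (x i) ≤ r * ∑ j, ‖b j‖ := by
  have h : ∑ i, e i * linFun φ b (x i) = ∑ j, inner ℝ (∑ i, e i • φ j (x i)) (b j) := by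
    simp only [linFun, Finset.mul_sum, sum_inner, inner_smul_left, conj_trivial]
    exact Finset.sum_comm
  rw [h, Finset.mul_sum]
  refine Finset.sum_le_sum fun j _ => (real_inner_le_norm _ _).trans ?_
  exact mul_le_mul_of_nonneg_right (hr j) (norm_nonneg _)

theorem mul_sum_norm_le_of_le_compatConst {φ : FeatureMaps 𝒳 d} {k n : ℕ} {x : Fin n → 𝒳}
    {cκ : ℝ} (hκ : ENNReal.ofReal cκ ≤ compatConst φ k x) {J : Finset (Fin p)} (hJ : J.card ≤ k)
    {b : Coef d} (hb : ∑ j ∈ Jᶜ, ‖b j‖ ≤ 3 * ∑ j ∈ J, ‖b j‖) :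
    cκ * ∑ j ∈ J, ‖b j‖ ≤ 1 / √(n : ℝ) * √(∑ i, linFun φ b (x i) ^ 2) := by
  rcases (Finset.sum_nonneg fun j (_ : j ∈ J) => norm_nonneg (b j)).eq_or_lt with h0 | h0
  · rw [← h0, mul_zero]; positivity
  have hb0 : b ≠ 0 := by
    rintro rfl
    simp at h0
  have h := hκ.trans (iInf_le_of_le J (iInf_le_of_le b (iInf_le_of_le hJ (iInf_le_of_le hb0
    (iInf_le_of_le hb le_rfl)))))
  rw [ENNReal.ofReal_le_ofReal_iff (by positivity), mul_div_assoc', le_div_iff₀ h0] at h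
  exact h

/-- The basic inequality of the group lasso with truth `β`. -/
theorem groupLasso_basic_inequality {φ : FeatureMaps 𝒳 d} {lam : ℝ} (hlam : 0 < lam) {n : ℕ}
    (hn : 0 < n) {x : Fin n → 𝒳} {J : Finset (Fin p)} {β b : Coef d}
    (hβ : ∀ j ∉ J, β j = 0) {e : Fin n → ℝ}
    (hsol : IsGroupLassoSolution φ lam x (fun i => linFun φ β (x i) + e i) b)
    (he : ∀ j, ‖∑ i, e i • φ j (x i)‖ ≤ lam * n / 4) :
    1 / (n : ℝ) * ∑ i, linFun φ (b - β) (x i) ^ 2 + lam / 2 * ∑ j ∈ Jᶜ, ‖(b - β) j‖ ≤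
      3 / 2 * lam * ∑ j ∈ J, ‖(b - β) j‖ := by
  have hn' : (0 : ℝ) < n := by exact_mod_cast hn
  have h := hsol β
  simp only [groupLassoLoss] at h
  have h1 : ∀ i, (linFun φ β (x i) + e i - linFun φ b (x i)) ^ 2 =
      e i ^ 2 - 2 * (e i * linFun φ (b - β) (x i)) + linFun φ (b - β) (x i) ^ 2 := by
    intro i
    rw [linFun_sub]
    ring
  simp only [h1, add_sub_cancel_left, Finset.sum_add_distrib, Finset.sum_sub_distrib,
    ← Finset.mul_sum] at h
  -- The noise bound `lam * n / 4` makes the cross term at most half the penalty of `b - β`; this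
  -- slack produces the factors `1/2` and `3/2`.
  have h2 := sum_mul_linFun_le φ x e (b - β) he
  have h3 : 1 / (n : ℝ) * (2 * ∑ i, e i * linFun φ (b - β) (x i)) ≤
      lam / 2 * ∑ j, ‖(b - β) j‖ := by
    calc 1 / (n : ℝ) * (2 * ∑ i, e i * linFun φ (b - β) (x i))
        ≤ 1 / (n : ℝ) * (2 * (lam * n / 4 * ∑ j, ‖(b - β) j‖)) := by gcongr
      _ = lam / 2 * ∑ j, ‖(b - β) j‖ := by field_simp; ring
  have h4 : ∑ j, ‖β j‖ - ∑ j, ‖b j‖ ≤ ∑ j ∈ J, ‖(b - β) j‖ - ∑ j ∈ Jᶜ, ‖(b - β) j‖ := by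
    rw [← Finset.sum_add_sum_compl J fun j => ‖β j‖, ← Finset.sum_add_sum_compl J fun j => ‖b j‖]
    have h5 : ∑ j ∈ J, ‖β j‖ ≤ ∑ j ∈ J, ‖b j‖ + ∑ j ∈ J, ‖(b - β) j‖ := by
      rw [← Finset.sum_add_distrib]
      refine Finset.sum_le_sum fun j _ => ?_
      rw [Pi.sub_apply, norm_sub_rev]
      exact norm_le_insert' _ _
    have h6 : ∑ j ∈ Jᶜ, ‖β j‖ = 0 :=
      Finset.sum_eq_zero fun j hj => by rw [hβ j (Finset.mem_compl.1 hj), norm_zero]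
    have h7 : ∑ j ∈ Jᶜ, ‖(b - β) j‖ = ∑ j ∈ Jᶜ, ‖b j‖ :=
      Finset.sum_congr rfl fun j hj => by
        rw [Pi.sub_apply, hβ j (Finset.mem_compl.1 hj), sub_zero]
    linarith
  have h8 := mul_le_mul_of_nonneg_left h4 hlam.le
  have h9 := Finset.sum_add_sum_compl J fun j => ‖(b - β) j‖
  rw [← h9] at h3
  simp only [mul_add, mul_sub] at h h3 h8
  linarith

/-- Let `S` be the error mass on `J`. Compatibility turns the basic inequality into `cκ² S² ≤ 3/2 *
lam * S`, so `S ≤ 3/2 * lam / cκ²`. The cone condition bounds the mass off `J` by `3 S`, whence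
`9/2`. -/
theorem groupLasso_norm_sub_le {φ : FeatureMaps 𝒳 d} {lam cκ : ℝ} (hlam : 0 < lam)
    (hcκ : 0 < cκ) {k n : ℕ} (hn : 0 < n) {x : Fin n → 𝒳}
    (hκ : ENNReal.ofReal cκ ≤ compatConst φ k x) {J : Finset (Fin p)} (hJ : J.card ≤ k)
    {β b : Coef d} (hβ : ∀ j ∉ J, β j = 0) {e : Fin n → ℝ}
    (hsol : IsGroupLassoSolution φ lam x (fun i => linFun φ β (x i) + e i) b)
    (he : ∀ j, ‖∑ i, e i • φ j (x i)‖ ≤ lam * n / 4) (j : Fin p) :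
    ‖b j - β j‖ ≤ 9 / 2 * (lam / cκ ^ 2) := by
  have hn' : (0 : ℝ) < n := by exact_mod_cast hn
  have hbasic := groupLasso_basic_inequality hlam hn hβ hsol he
  set S := ∑ j ∈ J, ‖(b - β) j‖ with hS
  set S' := ∑ j ∈ Jᶜ, ‖(b - β) j‖ with hS'
  set Q := ∑ i, linFun φ (b - β) (x i) ^ 2 with hQ
  have hS0 : 0 ≤ S := Finset.sum_nonneg fun _ _ => norm_nonneg _
  have hQ0 : 0 ≤ Q := Finset.sum_nonneg fun _ _ => sq_nonneg _
  have hQn : 0 ≤ 1 / (n : ℝ) * Q := by positivity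
  have hS'0 : 0 ≤ S' := Finset.sum_nonneg fun _ _ => norm_nonneg _
  have hcone : S' ≤ 3 * S := by
    have : lam / 2 * S' ≤ lam / 2 * (3 * S) := by linarith
    exact le_of_mul_le_mul_left this (by linarith)
  have hcomp := mul_sum_norm_le_of_le_compatConst hκ hJ hcone
  have hsq : (cκ * S) ^ 2 ≤ 1 / (n : ℝ) * Q := by
    refine (pow_le_pow_left₀ (by positivity) hcomp 2).trans (le_of_eq ?_)
    rw [mul_pow, div_pow, Real.sq_sqrt hn'.le, Real.sq_sqrt hQ0, one_pow]
  have hSle : S ≤ 3 / 2 * (lam / cκ ^ 2) := by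
    rw [mul_div_assoc', le_div_iff₀ (by positivity)]
    rcases hS0.eq_or_lt with h0 | h0
    · rw [← h0]; simp; positivity
    · have : (S * cκ ^ 2) * S ≤ (3 / 2 * lam) * S := by
        have : 0 ≤ lam / 2 * S' := by positivity
        nlinarith
      exact le_of_mul_le_mul_right this h0
  have hpos : 0 ≤ lam / cκ ^ 2 := by positivity
  by_cases hj : j ∈ J
  · have h := Finset.single_le_sum (f := fun j => ‖(b - β) j‖) (fun _ _ => norm_nonneg _) hj
    simp only [Pi.sub_apply] at h hS
    linarith
  · have h := Finset.single_le_sum (f := fun j => ‖(b - β) j‖) (fun _ _ => norm_nonneg _)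
      (Finset.mem_compl.2 hj)
    simp only [Pi.sub_apply] at h hS'
    linarith

/-- On the event that the noise is dominated by the regularization, a client recovers the
support. -/
theorem clientSupport_eq {φ : FeatureMaps 𝒳 d} {lam cκ c₁ thr thrBar : ℝ} (hlam : 0 < lam)
    (hcκ : 0 < cκ) (hthrBar : thrBar = min thr (c₁ - thr)) (hlam' : lam ≤ thrBar * cκ ^ 2 / 8)
    {n : ℕ} (hn : 0 < n) {x : Fin n → 𝒳} {J : Finset (Fin p)}
    (hκ : ENNReal.ofReal cκ ≤ compatConst φ J.card x)
    {β b : Coef d} (hβ : ∀ j ∉ J, β j = 0) (hmin : ∀ j ∈ J, c₁ ≤ ‖β j‖) {e : Fin n → ℝ}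
    (hsol : IsGroupLassoSolution φ lam x (fun i => linFun φ β (x i) + e i) b)
    (he : ∀ j, ‖∑ i, e i • φ j (x i)‖ ≤ lam * n / 4) :
    clientSupport thr b = J := by
  have hbound : ∀ j, ‖b j - β j‖ < thrBar := by
    intro j
    have h := groupLasso_norm_sub_le hlam hcκ hn hκ le_rfl hβ hsol he j
    have h1 : lam / cκ ^ 2 ≤ thrBar / 8 := by
      rw [div_le_iff₀ (by positivity)]; linarith
    have h2 : 0 < lam / cκ ^ 2 := by positivity
    linarith
  have h1 : thrBar ≤ thr := hthrBar ▸ min_le_left _ _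
  have h2 : thrBar ≤ c₁ - thr := hthrBar ▸ min_le_right _ _
  ext j
  simp only [clientSupport, Finset.mem_filter, Finset.mem_univ, true_and]
  have h := hbound j
  refine ⟨fun hj => ?_, fun hj => ?_⟩
  · by_contra hjJ
    rw [hβ j hjJ, sub_zero] at h
    linarith
  · have h3 := hmin j hj
    have h4 : ‖β j‖ - ‖b j‖ ≤ ‖b j - β j‖ := by
      rw [norm_sub_rev]; exact norm_sub_norm_le _ _
    linarith

/-! ### The majority vote -/

/-- More than `m α` correct clients elect every true group. More than `m (1 - α)` of them leave
fewer than `m α` votes for a false one. -/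
theorem majorityVote_eq {m : ℕ} {α : ℝ} {S : Fin m → Finset (Fin p)} {J : Finset (Fin p)}
    (h : m * max α (1 - α) < ((Finset.univ.filter fun s => S s = J).card : ℝ)) :
    majorityVote α S = J := by
  have hm : (0 : ℝ) ≤ m := Nat.cast_nonneg m
  have h1 := (mul_le_mul_of_nonneg_left (le_max_left α (1 - α)) hm).trans_lt h
  have h2 := (mul_le_mul_of_nonneg_left (le_max_right α (1 - α)) hm).trans_lt h
  ext j
  simp only [majorityVote, Finset.mem_filter, Finset.mem_univ, true_and]
  refine ⟨fun hj => ?_, fun hj => ?_⟩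
  · by_contra hjJ
    have hdisj : Disjoint (Finset.univ.filter fun s => S s = J)
        (Finset.univ.filter fun s => j ∈ S s) := by
      rw [Finset.disjoint_filter]
      rintro s - rfl
      exact hjJ
    have hcard := Finset.card_le_univ ((Finset.univ.filter fun s => S s = J) ∪
        (Finset.univ.filter fun s => j ∈ S s))
    rw [Finset.card_union_of_disjoint hdisj, Fintype.card_fin] at hcard
    have hcard' : ((Finset.univ.filter fun s => S s = J).card : ℝ) +
      ((Finset.univ.filter fun s => j ∈ S s).card : ℝ) ≤ m := by exact_mod_cast hcard
    linarith
  · refine h1.trans_le ?_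
    exact_mod_cast Finset.card_le_card
      (Finset.monotone_filter_right _ fun s _ (hs : S s = J) => hs ▸ hj)

end FedKGL

/-! ### The Chernoff bound for independent events -/

/-- Independent variables indexed by pairs are independent when collected into blocks. -/
theorem iIndepFun_curry {Ω ι : Type*} [MeasurableSpace Ω] {P : Measure Ω} {κ : ι → Type*}
    {X : (i : ι) → κ i → Ω → ℝ} (mX : ∀ i j, Measurable (X i j))
    (h : iIndepFun (fun (q : (i : ι) × κ i) ω => X q.1 q.2 ω) P) :
    iIndepFun (fun i ω => (X i · ω)) P := by
  have := h.isProbabilityMeasure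
  have : ∀ i j, IsProbabilityMeasure (P.map (X i j)) :=
    fun i j => Measure.isProbabilityMeasure_map (mX i j).aemeasurable
  have hrow : ∀ i, iIndepFun (X i) P := fun i =>
    h.precomp (g := fun j => (⟨i, j⟩ : (i : ι) × κ i)) sigma_mk_injective
  have hcomp : (MeasurableEquiv.piCurry fun i (_ : κ i) => ℝ) ∘
      (fun ω (q : (i : ι) × κ i) => X q.1 q.2 ω) = fun ω i j => X i j ω := by
    ext; simp [Sigma.curry]
  rw [iIndepFun_iff_map_fun_eq_infinitePi_map (by fun_prop)] at h ⊢
  -- Independence says that the joint law is a product, and currying carries the product over pairs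
  -- to the product of the row products.
  rw [← hcomp, ← Measure.map_map (by fun_prop) (by fun_prop), h,
    Measure.infinitePi_map_piCurry (fun i j => P.map (X i j))]
  congrm Measure.infinitePi fun i => ?_
  rw [(iIndepFun_iff_map_fun_eq_infinitePi_map (by fun_prop)).1 (hrow i)]

/-- A form of AM-GM, by multiplying `z / C ≤ exp (z / C - 1)`. It lets clients with different
success probabilities enter only through their mean. -/
theorem prod_le_pow_of_sum_le {m : ℕ} {z : Fin m → ℝ} (hz : ∀ s, 0 ≤ z s) {C : ℝ} (hC : 0 < C)
    (h : ∑ s, z s ≤ m * C) : ∏ s, z s ≤ C ^ m := by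
  have h1 : ∏ s, z s / C ≤ ∏ s, Real.exp (z s / C - 1) :=
    Finset.prod_le_prod (fun s _ => div_nonneg (hz s) hC.le) fun s _ => by
      linarith [Real.add_one_le_exp (z s / C - 1)]
  rw [← Real.exp_sum, Finset.prod_div_distrib, Finset.sum_sub_distrib, ← Finset.sum_div] at h1
  simp only [Finset.prod_const, Finset.sum_const, Finset.card_univ, Fintype.card_fin,
    nsmul_eq_mul, mul_one] at h1
  have h2 : (∑ s, z s) / C - m ≤ 0 := by
    rw [sub_nonpos, div_le_iff₀ hC]; exact h
  have h3 := h1.trans (Real.exp_le_one_iff.2 h2)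
  rwa [div_le_one (by positivity)] at h3

open Classical in
/-- The Chernoff bound for the number of independent events that occur. -/
theorem measureReal_card_le_le_exp_bernoulliKL {Ω : Type*} [MeasurableSpace Ω] {μ : Measure Ω}
    [IsProbabilityMeasure μ] {m : ℕ} {A : Fin m → Set Ω} (hA : ∀ s, MeasurableSet (A s))
    (hind : iIndepFun (fun s => (A s).indicator fun _ => (1 : ℝ)) μ) {a v : ℝ} (ha : 0 < a)
    (hav : a < v) (hv : v < 1) (hmean : m * v ≤ ∑ s, μ.real (A s)) :
    μ.real {w | ((Finset.univ.filter fun s => w ∈ A s).card : ℝ) ≤ m * a} ≤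
      Real.exp (-m * FedKGL.bernoulliKL a v) := by
  have hv0 : 0 < v := ha.trans hav
  have ha1 : 0 < 1 - a := by linarith
  have hv1 : 0 < 1 - v := by linarith
  -- This `r` minimizes the Chernoff factor `r^(-a) * (1 - v + r v)`; there `1 - v + r v = (1 - v) /
  -- (1 - a)`. As `r < 1`, a small count means a large `r ^ count`.
  set r := a * (1 - v) / (v * (1 - a)) with hr
  have hr0 : 0 < r := by positivity
  have hr1 : r < 1 := by
    rw [hr, div_lt_one (by positivity)]; linarith
  have hlogr : Real.log r < 0 := Real.log_neg hr0 hr1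
  set X : Fin m → Ω → ℝ≥0∞ := fun s w =>
    ENNReal.ofReal (1 - (1 - r) * (A s).indicator (fun _ => (1 : ℝ)) w) with hX
  have hXind : iIndepFun X μ :=
    hind.comp (fun _ (x : ℝ) => ENNReal.ofReal (1 - (1 - r) * x)) fun _ => by fun_prop
  have hAm : ∀ s, Measurable ((A s).indicator fun _ => (1 : ℝ)) := fun s =>
    measurable_const.indicator (hA s)
  have hXm : ∀ s, Measurable (X s) := fun s => by
    have := hAm s
    fun_prop
  have hXr : ∀ s w, X s w = ENNReal.ofReal (if w ∈ A s then r else 1) := by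
    intro s w
    by_cases h : w ∈ A s <;> simp [hX, h]
  have hprod : ∀ w, ∏ s, X s w =
      ENNReal.ofReal (r ^ (Finset.univ.filter fun s => w ∈ A s).card) := by
    intro w
    simp only [hXr]
    rw [← ENNReal.ofReal_prod_of_nonneg fun s _ => by split_ifs <;> positivity,
      Finset.prod_ite]
    simp
  have hint : ∀ s, ∫⁻ w, X s w ∂μ = ENNReal.ofReal (1 - (1 - r) * μ.real (A s)) := by
    intro s
    have hi : Integrable ((A s).indicator fun _ => (1 : ℝ)) μ :=
      (integrable_const 1).indicator (hA s)
    have hnn : ∀ w, 0 ≤ 1 - (1 - r) * (A s).indicator (fun _ => (1 : ℝ)) w := by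
      intro w
      by_cases h : w ∈ A s <;> simp [h, hr0.le]
    simp only [hX]
    rw [← ofReal_integral_eq_lintegral_ofReal (by fun_prop)
      (ae_of_all _ hnn), integral_sub (integrable_const _) (hi.const_mul _),
      integral_const_mul, integral_indicator_const _ (hA s)]
    simp
  have hE : ∫⁻ w, ∏ s, X s w ∂μ ≤ ENNReal.ofReal (((1 - v) / (1 - a)) ^ m) := by
    rw [lintegral_prod_eq_prod_lintegral_of_indepFun _ _ hXind hXm]
    simp only [hint]
    have hz : ∀ s, 0 ≤ 1 - (1 - r) * μ.real (A s) := fun s => by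
      have h1 : μ.real (A s) ≤ 1 := measureReal_le_one
      have h0 : 0 ≤ μ.real (A s) := measureReal_nonneg
      nlinarith
    rw [← ENNReal.ofReal_prod_of_nonneg fun s _ => hz s]
    refine ENNReal.ofReal_le_ofReal (prod_le_pow_of_sum_le hz (by positivity) ?_)
    rw [Finset.sum_sub_distrib, ← Finset.mul_sum]
    simp only [Finset.sum_const, Finset.card_univ, Fintype.card_fin, nsmul_eq_mul, mul_one]
    have h1 : (1 - v) / (1 - a) = 1 - (1 - r) * v := by
      rw [hr]; field_simp; ring
    rw [h1]
    nlinarith [mul_le_mul_of_nonneg_left hmean (sub_pos.2 hr1).le]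
  have hsubset : {w | ((Finset.univ.filter fun s => w ∈ A s).card : ℝ) ≤ m * a} ⊆
      {w | ENNReal.ofReal (Real.exp (m * a * Real.log r)) ≤ ∏ s, X s w} := by
    intro w hw
    simp only [Set.mem_ofPred_eq] at hw ⊢
    rw [hprod]
    refine ENNReal.ofReal_le_ofReal ?_
    rw [← Real.rpow_natCast, Real.rpow_def_of_pos hr0, mul_comm (Real.log r)]
    exact Real.exp_le_exp.2 (mul_le_mul_of_nonpos_right hw hlogr.le)
  have hmarkov : μ {w | ENNReal.ofReal (Real.exp (m * a * Real.log r)) ≤ ∏ s, X s w} ≤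
      ENNReal.ofReal (Real.exp (-m * FedKGL.bernoulliKL a v)) := by
    refine (meas_ge_le_lintegral_div
      (Finset.measurable_prod _ fun s _ => hXm s).aemeasurable
      (by simp [Real.exp_pos]) ENNReal.ofReal_ne_top).trans ?_
    refine (ENNReal.div_le_div_right hE _).trans (le_of_eq ?_)
    rw [← ENNReal.ofReal_div_of_pos (Real.exp_pos _)]
    congr 1
    rw [← Real.rpow_natCast, Real.rpow_def_of_pos (by positivity), ← Real.exp_sub]
    congr 1
    rw [FedKGL.bernoulliKL, hr, Real.log_div (by positivity) (by positivity),
      Real.log_div (by positivity) (by positivity), Real.log_div (by positivity) (by positivity),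
      Real.log_div (by positivity) (by positivity), Real.log_mul (by positivity) (by positivity),
      Real.log_mul (by positivity) (by positivity)]
    ring
  exact ENNReal.toReal_le_of_le_ofReal (Real.exp_pos _).le ((measure_mono hsubset).trans hmarkov)

/-- A lower bound for the relative entropy of Bernoulli laws with parameters above one half. -/
theorem sq_div_le_bernoulliKL {a v : ℝ} (ha : 1 / 2 ≤ a) (hav : a ≤ v) (hv : v < 1) :
    (v - a) ^ 2 / (2 * a * (1 - a)) ≤ FedKGL.bernoulliKL a v := by
  have ha0 : 0 < a := by linarith
  have ha1 : 0 < 1 - a := by linarith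
  set f : ℝ → ℝ := fun x => a * (Real.log a - Real.log x) +
    (1 - a) * (Real.log (1 - a) - Real.log (1 - x)) - (x - a) ^ 2 / (2 * a * (1 - a)) with hf
  have hderiv : ∀ x ∈ Set.Ico a 1, HasDerivAt f
      (a * (-x⁻¹) + (1 - a) * (1 - x)⁻¹ - 2 * (x - a) / (2 * a * (1 - a))) x := by
    intro x hx
    have hx0 : x ≠ 0 := by have := hx.1; linarith
    have hx1 : 1 - x ≠ 0 := by have := hx.2; linarith
    have h1 := ((Real.hasDerivAt_log hx0).const_sub (Real.log a)).const_mul a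
    have h2 := ((((hasDerivAt_id x).const_sub 1).log hx1).const_sub
      (Real.log (1 - a))).const_mul (1 - a)
    have h3 := (((hasDerivAt_id x).sub_const a).pow 2).div_const (2 * a * (1 - a))
    refine ((h1.add h2).sub h3).congr_deriv ?_
    simp [div_eq_mul_inv]
  have hmono : MonotoneOn f (Set.Ico a 1) := by
    refine monotoneOn_of_deriv_nonneg (convex_Ico a 1)
      (fun x hx => (hderiv x hx).continuousAt.continuousWithinAt)
      (fun x hx => (hderiv x (interior_subset hx)).differentiableAt.differentiableWithinAt)
      fun x hx => ?_
    have hx := interior_subset hx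
    rw [(hderiv x hx).deriv]
    have hx0 : 0 < x := ha0.trans_le hx.1
    have hx1 : 0 < 1 - x := by have := hx.2; linarith
    have hxa : 0 ≤ x - a := sub_nonneg.2 hx.1
    -- In this factorization the only sign in doubt is that of `x + a - 1`, nonnegative because `x ≥
    -- a ≥ 1/2`. So `f` increases from `f a = 0`.
    have h1 : a * (-x⁻¹) + (1 - a) * (1 - x)⁻¹ - 2 * (x - a) / (2 * a * (1 - a)) =
        (x - a) * ((x - a) * (x + a - 1)) / (x * (1 - x) * (a * (1 - a))) := by
      field_simp
      ring
    rw [h1]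
    have : 0 ≤ x + a - 1 := by linarith
    positivity
  have h := hmono ⟨le_rfl, by linarith⟩ ⟨hav, hv⟩ hav
  have hv0 : 0 < v := by linarith
  have hv1 : 0 < 1 - v := by linarith
  rw [FedKGL.bernoulliKL, Real.log_div ha0.ne' hv0.ne', Real.log_div ha1.ne' hv1.ne']
  simp only [hf, sub_self] at h
  norm_num at h
  linarith

open Classical in
theorem one_sub_exp_bernoulliKL_le_measureReal_lt_card {Ω : Type*} [MeasurableSpace Ω]
    {μ : Measure Ω} [IsProbabilityMeasure μ] {m : ℕ} {A : Fin m → Set Ω}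
    (hA : ∀ s, MeasurableSet (A s))
    (hind : iIndepFun (fun s => (A s).indicator fun _ => (1 : ℝ)) μ) {a v : ℝ} (ha : 0 < a)
    (hav : a < v) (hv : v < 1) (hmean : m * v ≤ ∑ s, μ.real (A s)) :
    1 - Real.exp (-m * FedKGL.bernoulliKL a v) ≤
      μ.real {w | m * a < ((Finset.univ.filter fun s => w ∈ A s).card : ℝ)} := by
  have h := measureReal_card_le_le_exp_bernoulliKL hA hind ha hav hv hmean
  have h1 : (1 : ℝ) ≤ μ.real {w | ((Finset.univ.filter fun s => w ∈ A s).card : ℝ) ≤ m * a} +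
      μ.real {w | m * a < ((Finset.univ.filter fun s => w ∈ A s).card : ℝ)} := by
    refine le_trans (le_of_eq ?_) (measureReal_union_le _ _)
    rw [← probReal_univ (μ := μ)]
    congr 1
    ext w
    simp [le_or_gt]
  linarith

-- Unlike the relative entropy, the quadratic rate is continuous at `v = 1`, so that case follows by
-- letting `v'` increase to `v`.
open Classical in
theorem one_sub_exp_sq_le_measureReal_lt_card {Ω : Type*} [MeasurableSpace Ω]
    {μ : Measure Ω} [IsProbabilityMeasure μ] {m : ℕ} {A : Fin m → Set Ω}
    (hA : ∀ s, MeasurableSet (A s))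
    (hind : iIndepFun (fun s => (A s).indicator fun _ => (1 : ℝ)) μ) {a v : ℝ} (ha : 1 / 2 ≤ a)
    (hav : a < v) (hv : v ≤ 1) (hmean : m * v ≤ ∑ s, μ.real (A s)) :
    1 - Real.exp (-m * ((v - a) ^ 2 / (2 * a * (1 - a)))) ≤
      μ.real {w | m * a < ((Finset.univ.filter fun s => w ∈ A s).card : ℝ)} := by
  have hlt : ∀ v' ∈ Set.Ioo a v, 1 - Real.exp (-m * ((v' - a) ^ 2 / (2 * a * (1 - a)))) ≤
      μ.real {w | m * a < ((Finset.univ.filter fun s => w ∈ A s).card : ℝ)} := by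
    intro v' hv'
    have hm : (0 : ℝ) ≤ m := Nat.cast_nonneg m
    refine le_trans ?_ (one_sub_exp_bernoulliKL_le_measureReal_lt_card hA hind (by linarith)
      hv'.1 (hv'.2.trans_le hv) ((mul_le_mul_of_nonneg_left hv'.2.le hm).trans hmean))
    have h := mul_le_mul_of_nonneg_left
      (sq_div_le_bernoulliKL ha hv'.1.le (hv'.2.trans_le hv)) hm
    have h1 := Real.exp_le_exp.2 (neg_le_neg h)
    rw [← neg_mul, ← neg_mul] at h1
    linarith
  have hcont : Tendsto (fun v' : ℝ => 1 - Real.exp (-m * ((v' - a) ^ 2 / (2 * a * (1 - a)))))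
      (𝓝[<] v) (𝓝 (1 - Real.exp (-m * ((v - a) ^ 2 / (2 * a * (1 - a)))))) :=
    (Continuous.tendsto (by fun_prop) v).mono_left nhdsWithin_le_nhds
  exact le_of_tendsto hcont (eventually_of_mem (Ioo_mem_nhdsLT hav) hlt)

/-! ### Federated support recovery -/

namespace FedKGL

variable {𝒳 : Type*} {p : ℕ} {d : Fin p → ℕ}

theorem groupGram_posSemidef (φ : FeatureMaps 𝒳 d) {n : ℕ} (x : Fin n → 𝒳) (j : Fin p) :
    (groupGram φ x j).PosSemidef := by
  simpa [groupGram, Matrix.conjTranspose_eq_transpose_of_trivial] using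
    Matrix.posSemidef_self_mul_conjTranspose (groupDesign φ x j)

theorem groupGram_apply (φ : FeatureMaps 𝒳 d) {n : ℕ} (x : Fin n → 𝒳) (j : Fin p) (i k : Fin n) :
    groupGram φ x j i k = baseKernel φ j (x i) (x k) := by
  simp [groupGram, groupDesign, Matrix.mul_apply, baseKernel, PiLp.inner_apply, mul_comm]

theorem groupGram_quadraticForm (φ : FeatureMaps 𝒳 d) {n : ℕ} (x : Fin n → 𝒳) (j : Fin p)
    (e : Fin n → ℝ) : e ⬝ᵥ (groupGram φ x j).mulVec e = ‖∑ i, e i • φ j (x i)‖ ^ 2 := by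
  rw [← real_inner_self_eq_norm_sq]
  simp only [dotProduct, Matrix.mulVec, groupGram_apply, baseKernel, sum_inner, inner_sum,
    inner_smul_left, inner_smul_right, conj_trivial, Finset.mul_sum]
  exact Finset.sum_congr rfl fun i _ => Finset.sum_congr rfl fun k _ => by
    rw [real_inner_comm]; ring

theorem trace_groupGram_le {φ : FeatureMaps 𝒳 d} (hφ : ∀ j x x', baseKernel φ j x x' ≤ 1) {n : ℕ}
    (x : Fin n → 𝒳) (j : Fin p) : (groupGram φ x j).trace ≤ n := by
  calc (groupGram φ x j).trace ≤ ∑ _i : Fin n, (1 : ℝ) := by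
        refine Finset.sum_le_sum fun i _ => ?_
        rw [Matrix.diag_apply, groupGram_apply]
        exact hφ j _ _
    _ = n := by simp

theorem groupFailure_nonneg (φ : FeatureMaps 𝒳 d) (lam σ : ℝ) {n : ℕ} (x : Fin n → 𝒳)
    (j : Fin p) : 0 ≤ groupFailure φ lam σ x j := by
  unfold groupFailure
  split_ifs
  · exact le_rfl
  · exact (Real.exp_pos _).le

theorem clientLevel_le_one (φ : FeatureMaps 𝒳 d) (lam σ : ℝ) {n : ℕ} (x : Fin n → 𝒳) :
    clientLevel φ lam σ x ≤ 1 := by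
  have h := Real.iSup_nonneg (groupFailure_nonneg φ lam σ x)
  have : (0 : ℝ) ≤ p * ⨆ j, groupFailure φ lam σ x j := by positivity
  unfold clientLevel
  linarith

/-- Trace and spectral norm are both at most `n` for bounded kernels, which removes the dependence
on the design. -/
theorem groupFailure_le {φ : FeatureMaps 𝒳 d} (hφ : ∀ j x x', baseKernel φ j x x' ≤ 1)
    {lam σ : ℝ} {n : ℕ} (x : Fin n → 𝒳) (hR : √(n : ℝ) < lam * n / (4 * σ)) (j : Fin p) :
    groupFailure φ lam σ x j ≤
      Real.exp (-(lam * n / (4 * σ) - √(n : ℝ)) ^ 2 / (2 * n)) := by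
  unfold groupFailure
  split_ifs with h0
  · exact (Real.exp_pos _).le
  have hT := trace_groupGram_le hφ x j
  have hL := (norm_toEuclideanCLM_le_trace (groupGram_posSemidef φ x j)).trans hT
  have hL0 : 0 < ‖Matrix.toEuclideanCLM (𝕜 := ℝ) (n := Fin n) (groupGram φ x j)‖ := by
    rw [norm_pos_iff]
    simpa using h0
  have hs := Real.sqrt_le_sqrt hT
  rw [Real.exp_le_exp, neg_div, neg_div, neg_le_neg_iff]
  have h1 : (lam * n / (4 * σ) - √(n : ℝ)) ^ 2 ≤
      (lam * n / (4 * σ) - √(groupGram φ x j).trace) ^ 2 :=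
    pow_le_pow_left₀ (by linarith) (by linarith) 2
  exact div_le_div₀ (sq_nonneg _) h1 (by positivity) (by linarith)

namespace Experiment

variable {Ω : Type*} {m : ℕ} {n : Fin m → ℕ}

/-- The event that the noise of client `s` is dominated by the regularization. -/
def noiseEvent (E : Experiment 𝒳 Ω d m n) (φ : FeatureMaps 𝒳 d) (lam : ℝ) (s : Fin m) : Set Ω :=
  {w | ∀ j, ‖∑ i, E.ε s i w • φ j (E.x s i)‖ ≤ lam * n s / 4}

variable [MeasurableSpace Ω] {μ : Measure Ω} {E : Experiment 𝒳 Ω d m n} {φ : FeatureMaps 𝒳 d}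
  {Jstar : Finset (Fin p)} {σ : ℝ≥0} {c₁ cκ lam : ℝ}

theorem Assumptions.measurableSet_noiseEvent (hE : E.Assumptions μ φ Jstar σ c₁ cκ lam)
    (s : Fin m) : MeasurableSet (E.noiseEvent φ lam s) := by
  have := hE.noise_measurable
  simp only [noiseEvent, Set.ofPred_forall]
  exact MeasurableSet.iInter fun j => measurableSet_le (by fun_prop) measurable_const

theorem Assumptions.iIndepFun_indicator_noiseEvent (hE : E.Assumptions μ φ Jstar σ c₁ cκ lam) :
    iIndepFun (fun s => (E.noiseEvent φ lam s).indicator fun _ => (1 : ℝ)) μ := by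
  have h := iIndepFun_curry hE.noise_measurable hE.noise_indep
  have hT : ∀ s, MeasurableSet
      {e : Fin (n s) → ℝ | ∀ j, ‖∑ i, e i • φ j (E.x s i)‖ ≤ lam * n s / 4} := by
    intro s
    simp only [Set.ofPred_forall]
    exact MeasurableSet.iInter fun j => measurableSet_le (by fun_prop) measurable_const
  exact h.comp (fun s => {e : Fin (n s) → ℝ |
    ∀ j, ‖∑ i, e i • φ j (E.x s i)‖ ≤ lam * n s / 4}.indicator fun _ => (1 : ℝ))
    fun s => measurable_const.indicator (hT s)

theorem Assumptions.measureReal_noise_le_groupFailure [IsProbabilityMeasure μ]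
    (hE : E.Assumptions μ φ Jstar σ c₁ cκ lam) (hσ : 0 < σ) (s : Fin m) (j : Fin p)
    (hR : √(groupGram φ (E.x s) j).trace < lam * n s / (4 * σ)) :
    μ.real {w | lam * n s / 4 < ‖∑ i, E.ε s i w • φ j (E.x s i)‖} ≤
      groupFailure φ lam σ (E.x s) j := by
  have hσ' : (0 : ℝ) < σ := by exact_mod_cast hσ
  have hR0 := (Real.sqrt_nonneg _).trans_lt hR
  have hR1 : σ * (lam * n s / (4 * σ)) = lam * n s / 4 := by field_simp
  have hpos : 0 < lam * n s / 4 := hR1 ▸ mul_pos hσ' hR0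
  unfold groupFailure
  split_ifs with h0
  -- For a zero Gram matrix the noise term vanishes identically, so the failure event is empty,
  -- matching the value `0` of `groupFailure`.
  · refine le_of_eq ?_
    have : {w | lam * n s / 4 < ‖∑ i, E.ε s i w • φ j (E.x s i)‖} = ∅ := by
      ext w
      have h := groupGram_quadraticForm φ (E.x s) j fun i => E.ε s i w
      rw [h0, Matrix.zero_mulVec, dotProduct_zero, eq_comm, sq_eq_zero_iff] at h
      simp [h, hpos.le]
    rw [this, measureReal_empty]
  · have hrow : iIndepFun (E.ε s) μ :=
      hE.noise_indep.precomp (g := Sigma.mk s) sigma_mk_injective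
    have hm := hE.noise_measurable s
    have key := measure_quadraticForm_ge_le (μ := μ) (e := fun w => WithLp.toLp 2 fun i => E.ε s i w)
      (by fun_prop) hσ'
      (fun u => by
        simpa using lintegral_exp_inner_le_of_iIndepFun hrow (hE.noise_subgaussian s) u)
      (groupGram_posSemidef φ (E.x s) j) h0 hR
    refine ENNReal.toReal_le_of_le_ofReal (Real.exp_pos _).le ((measure_mono ?_).trans key)
    intro w hw
    change (σ * (lam * n s / (4 * σ))) ^ 2 ≤ _
    rw [groupGram_quadraticForm, hR1]
    exact pow_le_pow_left₀ hpos.le (le_of_lt hw) 2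

theorem Assumptions.clientLevel_le_measureReal_noiseEvent [IsProbabilityMeasure μ]
    (hE : E.Assumptions μ φ Jstar σ c₁ cκ lam) (hσ : 0 < σ) (s : Fin m)
    (hR : ∀ j, √(groupGram φ (E.x s) j).trace < lam * n s / (4 * σ)) :
    clientLevel φ lam σ (E.x s) ≤ μ.real (E.noiseEvent φ lam s) := by
  have h1 : μ.real (E.noiseEvent φ lam s)ᶜ ≤ p * ⨆ j, groupFailure φ lam σ (E.x s) j := by
    have h2 : (E.noiseEvent φ lam s)ᶜ =
        ⋃ j, {w | lam * n s / 4 < ‖∑ i, E.ε s i w • φ j (E.x s i)‖} := by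
      ext w
      simp [noiseEvent]
    rw [h2]
    refine (measureReal_iUnion_fintype_le _).trans ?_
    calc ∑ j, μ.real {w | lam * n s / 4 < ‖∑ i, E.ε s i w • φ j (E.x s i)‖}
        ≤ ∑ _j : Fin p, ⨆ j, groupFailure φ lam σ (E.x s) j := by
          refine Finset.sum_le_sum fun j _ => ?_
          exact (hE.measureReal_noise_le_groupFailure hσ s j (hR j)).trans
            (le_ciSup (Set.finite_range _).bddAbove j)
      _ = p * ⨆ j, groupFailure φ lam σ (E.x s) j := by simp
  rw [probReal_compl_eq_one_sub (hE.measurableSet_noiseEvent s)] at h1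
  unfold clientLevel
  linarith

theorem Assumptions.one_sub_le_measureReal_noiseEvent [IsProbabilityMeasure μ]
    (hφ : ∀ j x x', baseKernel φ j x x' ≤ 1)
    (hE : E.Assumptions μ φ Jstar σ c₁ cκ lam) (hσ : 0 < σ) (s : Fin m)
    (hR : √(n s : ℝ) < lam * n s / (4 * σ)) :
    1 - p * Real.exp (-(lam * n s / (4 * σ) - √(n s : ℝ)) ^ 2 / (2 * n s)) ≤
      μ.real (E.noiseEvent φ lam s) := by
  refine le_trans ?_ (hE.clientLevel_le_measureReal_noiseEvent hσ s fun j =>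
    (Real.sqrt_le_sqrt (trace_groupGram_le hφ (E.x s) j)).trans_lt hR)
  unfold clientLevel
  have h := Real.iSup_le (groupFailure_le (σ := σ) hφ (E.x s) hR) (Real.exp_pos _).le
  have := mul_le_mul_of_nonneg_left h (Nat.cast_nonneg p)
  linarith

open Classical in
/-- The server recovers the support if sufficiently many clients have small noise. -/
theorem Assumptions.Jhat_eq {thr thrBar α : ℝ} (hE : E.Assumptions μ φ Jstar σ c₁ cκ lam)
    (hlam : 0 < lam) (hcκ : 0 < cκ) (hthrBar : thrBar = min thr (c₁ - thr))
    (hlam' : lam ≤ thrBar * cκ ^ 2 / 8) (hn : ∀ s, 0 < n s) {w : Ω}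
    (hw : m * max α (1 - α) <
      ((Finset.univ.filter fun s => w ∈ E.noiseEvent φ lam s).card : ℝ)) :
    E.Jhat thr α w = Jstar := by
  refine majorityVote_eq (hw.trans_le ?_)
  refine Nat.cast_le.2 (Finset.card_le_card (Finset.monotone_filter_right _ fun s _ hs => ?_))
  exact clientSupport_eq hlam hcκ hthrBar hlam' (hn s) (hE.compatible s) (hE.sparse s)
    (hE.beta_min s) (hE.solution s w) hs

theorem measureReal_Jhat_eq_one_of_p_eq_zero [IsProbabilityMeasure μ] {thr α : ℝ} (hp : p = 0) :
    μ.real {w | E.Jhat thr α w = Jstar} = 1 := by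
  subst hp
  have : {w | E.Jhat thr α w = Jstar} = Set.univ := by
    ext w
    simp [Subsingleton.elim (E.Jhat thr α w) Jstar]
  rw [this, probReal_univ]

end Experiment

theorem half_le_max_one_sub (α : ℝ) : 1 / 2 ≤ max α (1 - α) := by
  rcases le_total α (1 / 2) with h | h
  · exact le_max_of_le_right (by linarith)
  · exact le_max_of_le_left h

/-- The quantitative bounds on the probability of support recovery. -/
theorem quantitative_bound {Ω : Type*} [MeasurableSpace Ω] {μ : Measure Ω}
    [IsProbabilityMeasure μ] {φ : FeatureMaps 𝒳 d} {Jstar : Finset (Fin p)} {σ : ℝ≥0}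
    (hσ : 0 < σ) {c₁ cκ thr thrBar α : ℝ} (hcκ : 0 < cκ)
    (hthrBar : thrBar = min thr (c₁ - thr)) (hα : 0 < α) (hα' : α < 1)
    {m : ℕ} {n : Fin m → ℕ} {lam : ℝ} {E : Experiment 𝒳 Ω d m n} {a v : ℝ}
    (hE : E.Assumptions μ φ Jstar σ c₁ cκ lam) (hlam' : lam ≤ thrBar * cκ ^ 2 / 8)
    (hR : ∀ s j, √(groupGram φ (E.x s) j).trace < lam * n s / (4 * σ))
    (ha : a = max α (1 - α)) (hv : v = (1 / (m : ℝ)) * ∑ s, clientLevel φ lam σ (E.x s))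
    (hav : a < v) :
    1 - Real.exp (-m * bernoulliKL a v) ≤ μ.real {w | E.Jhat thr α w = Jstar} ∧
      1 - Real.exp (-m * ((v - a) ^ 2 / (2 * a * (1 - a)))) ≤
        μ.real {w | E.Jhat thr α w = Jstar} := by
  classical
  have hσ' : (0 : ℝ) < σ := by exact_mod_cast hσ
  have ha2 : 1 / 2 ≤ a := ha ▸ half_le_max_one_sub α
  have ha0 : 0 < a := by linarith
  have ha1 : a < 1 := ha ▸ max_lt hα' (by linarith)
  rcases Nat.eq_zero_or_pos p with hp | hp
  · rw [Experiment.measureReal_Jhat_eq_one_of_p_eq_zero hp]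
    constructor <;> linarith [Real.exp_pos (-m * bernoulliKL a v),
      Real.exp_pos (-m * ((v - a) ^ 2 / (2 * a * (1 - a))))]
  -- Without clients the empty sum gives `v = 0`, contradicting `1/2 ≤ a < v`.
  rcases Nat.eq_zero_or_pos m with hm | hm
  · subst hm
    simp at hv
    linarith
  have hm' : (0 : ℝ) < m := by exact_mod_cast hm
  -- Positivity of `lam` and of each `n s` is forced by the trace condition, once some group and
  -- some client exist.
  have hln : ∀ s, 0 < lam * n s := by
    intro s
    have h := (Real.sqrt_nonneg _).trans_lt (hR s ⟨0, hp⟩)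
    have h1 : lam * n s = lam * n s / (4 * σ) * (4 * σ) := by field_simp
    rw [h1]
    positivity
  have hn : ∀ s, 0 < n s := by
    intro s
    refine Nat.pos_of_ne_zero fun h => ?_
    have := hln s
    simp [h] at this
  have hlam : 0 < lam := pos_of_mul_pos_left (hln ⟨0, hm⟩) (Nat.cast_nonneg _)
  have hmv : m * v = ∑ s, clientLevel φ lam σ (E.x s) := by
    rw [hv]; field_simp
  have hmean : m * v ≤ ∑ s, μ.real (E.noiseEvent φ lam s) := hmv.trans_le
    (Finset.sum_le_sum fun s _ => hE.clientLevel_le_measureReal_noiseEvent hσ s (hR s))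
  have hv1 : v ≤ 1 := by
    have h : m * v ≤ m * 1 := by
      rw [hmv]
      refine (Finset.sum_le_sum fun s _ => clientLevel_le_one φ lam σ (E.x s)).trans ?_
      simp
    exact le_of_mul_le_mul_left h hm'
  have hsub : {w | m * a < ((Finset.univ.filter fun s => w ∈ E.noiseEvent φ lam s).card : ℝ)} ⊆
      {w | E.Jhat thr α w = Jstar} := fun w hw =>
    hE.Jhat_eq hlam hcκ hthrBar hlam' hn (ha ▸ hw)
  have hA := hE.measurableSet_noiseEvent
  have hind := hE.iIndepFun_indicator_noiseEvent
  refine ⟨?_, (one_sub_exp_sq_le_measureReal_lt_card hA hind ha2 hav hv1 hmean).trans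
    (measureReal_mono hsub)⟩
  rcases hv1.lt_or_eq with hlt | rfl
  · exact (one_sub_exp_bernoulliKL_le_measureReal_lt_card hA hind ha0 hav hlt hmean).trans
      (measureReal_mono hsub)
  -- At `v = 1` the conventions `x / 0 = 0` and `log 0 = 0` reduce `bernoulliKL a 1` to `a * log a ≤
  -- 0`, so the claimed lower bound is not positive.
  · have h0 : a * Real.log a ≤ 0 :=
      mul_nonpos_of_nonneg_of_nonpos ha0.le (Real.log_nonpos ha0.le ha1.le)
    have h1 : 0 ≤ -m * bernoulliKL a 1 := by
      simp only [bernoulliKL, sub_self, div_zero, Real.log_zero, mul_zero, add_zero, div_one]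
      nlinarith
    have := Real.one_le_exp h1
    have h2 : 0 ≤ μ.real {w | E.Jhat thr α w = Jstar} := measureReal_nonneg
    linarith

theorem tendsto_measureReal_Jhat_sampleSize {Ω : Type*} [MeasurableSpace Ω] {μ : Measure Ω}
    [IsProbabilityMeasure μ] {φ : FeatureMaps 𝒳 d} (hφ : ∀ j x x', baseKernel φ j x x' ≤ 1)
    {Jstar : Finset (Fin p)} {σ : ℝ≥0}
    (hσ : 0 < σ) {c₁ cκ thr thrBar α lam : ℝ} (hcκ : 0 < cκ)
    (hthrBar : thrBar = min thr (c₁ - thr)) (hα : 0 < α) (hα' : α < 1) (hlam : 0 < lam)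
    (hlam' : lam ≤ thrBar * cκ ^ 2 / 8) {m : ℕ} (hm : 0 < m)
    (E : (N : ℕ) → Experiment 𝒳 Ω d m (fun _ => N))
    (hE : ∀ᶠ N in atTop, (E N).Assumptions μ φ Jstar σ c₁ cκ lam) :
    Tendsto (fun N => μ.real {w | (E N).Jhat thr α w = Jstar}) atTop (𝓝 1) := by
  classical
  have hσ' : (0 : ℝ) < σ := by exact_mod_cast hσ
  have hsqrt : Tendsto (fun N : ℕ => lam / (4 * σ) * √(N : ℝ) - 1) atTop atTop :=
    tendsto_atTop_add_const_right _ _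
      ((Real.tendsto_sqrt_atTop.comp tendsto_natCast_atTop_atTop).const_mul_atTop (by positivity))
  have hlim : Tendsto (fun N : ℕ => 1 - m * (p *
      Real.exp (-((lam / (4 * σ) * √(N : ℝ) - 1) ^ 2 / 2)))) atTop (𝓝 1) := by
    have h1 : Tendsto (fun N : ℕ => Real.exp (-((lam / (4 * σ) * √(N : ℝ) - 1) ^ 2 / 2)))
        atTop (𝓝 0) :=
      Real.tendsto_exp_neg_atTop_nhds_zero.comp
        (((tendsto_pow_atTop two_ne_zero).comp hsqrt).atTop_div_const two_pos)
    simpa using ((h1.const_mul (p : ℝ)).const_mul (m : ℝ)).const_sub 1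
  refine tendsto_of_tendsto_of_tendsto_of_le_of_le' hlim tendsto_const_nhds ?_
    (Eventually.of_forall fun N => measureReal_le_one)
  filter_upwards [hE, hsqrt.eventually_gt_atTop 0, eventually_gt_atTop 0] with N hEN hN hN0
  have hN0' : (0 : ℝ) < N := by exact_mod_cast hN0
  have hs0 : 0 < √(N : ℝ) := Real.sqrt_pos.2 hN0'
  have hNs : (N : ℝ) = √(N : ℝ) * √(N : ℝ) := (Real.mul_self_sqrt hN0'.le).symm
  have hfac : lam * N / (4 * σ) - √(N : ℝ) = √(N : ℝ) * (lam / (4 * σ) * √(N : ℝ) - 1) := by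
    nth_rewrite 1 [hNs]
    ring
  have hR : √(N : ℝ) < lam * N / (4 * σ) := by
    have := mul_pos hs0 hN
    linarith
  have hexp : -(lam * N / (4 * σ) - √(N : ℝ)) ^ 2 / (2 * N) =
      -((lam / (4 * σ) * √(N : ℝ) - 1) ^ 2 / 2) := by
    rw [hfac, mul_pow, Real.sq_sqrt hN0'.le]
    field_simp
  have hclient : ∀ s, 1 - p * Real.exp (-((lam / (4 * σ) * √(N : ℝ) - 1) ^ 2 / 2)) ≤
      μ.real ((E N).noiseEvent φ lam s) := fun s =>
    hexp ▸ hEN.one_sub_le_measureReal_noiseEvent hφ hσ s hR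
  have hA := hEN.measurableSet_noiseEvent
  -- For fixed `m` a union bound over clients suffices: all succeed at once, and `m * max α (1 - α)
  -- < m`.
  have hinter : 1 - m * (p * Real.exp (-((lam / (4 * σ) * √(N : ℝ) - 1) ^ 2 / 2))) ≤
      μ.real (⋂ s, (E N).noiseEvent φ lam s) := by
    have h1 : μ.real (⋂ s, (E N).noiseEvent φ lam s)ᶜ ≤
        m * (p * Real.exp (-((lam / (4 * σ) * √(N : ℝ) - 1) ^ 2 / 2))) := by
      rw [Set.compl_iInter]
      refine (measureReal_iUnion_fintype_le _).trans ((Finset.sum_le_sum (g := fun _ =>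
        (p * Real.exp (-((lam / (4 * σ) * √(N : ℝ) - 1) ^ 2 / 2)))) fun s _ => ?_).trans
          (by simp))
      rw [probReal_compl_eq_one_sub (hA s)]
      linarith [hclient s]
    rw [probReal_compl_eq_one_sub (MeasurableSet.iInter hA)] at h1
    linarith
  refine hinter.trans (measureReal_mono fun w hw => ?_)
  refine hEN.Jhat_eq hlam hcκ hthrBar hlam' (fun _ => hN0) ?_
  rw [Set.mem_iInter] at hw
  simp only [hw, Finset.filter_true, Finset.card_univ, Fintype.card_fin]
  have hm' : (0 : ℝ) < m := by exact_mod_cast hm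
  exact mul_lt_of_lt_one_right hm' (max_lt hα' (by linarith))

theorem tendsto_measureReal_Jhat_clients {Ω : Type*} [MeasurableSpace Ω] {μ : Measure Ω}
    [IsProbabilityMeasure μ] {φ : FeatureMaps 𝒳 d} (hφ : ∀ j x x', baseKernel φ j x x' ≤ 1)
    {Jstar : Finset (Fin p)} {σ : ℝ≥0}
    (hσ : 0 < σ) {c₁ cκ thr thrBar α lam : ℝ} (hcκ : 0 < cκ)
    (hthrBar : thrBar = min thr (c₁ - thr)) (hα : 0 < α) (hα' : α < 1) (hlam : 0 < lam)
    (hlam' : lam ≤ thrBar * cκ ^ 2 / 8) {N : ℕ} (hN : 0 < N)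
    (hlarge : √(2 * Real.log (p / min α (1 - α))) + 1 < lam / (4 * σ) * √(N : ℝ))
    (E : (m : ℕ) → Experiment 𝒳 Ω d m (fun _ => N))
    (hE : ∀ᶠ m in atTop, (E m).Assumptions μ φ Jstar σ c₁ cκ lam) :
    Tendsto (fun m => μ.real {w | (E m).Jhat thr α w = Jstar}) atTop (𝓝 1) := by
  classical
  rcases Nat.eq_zero_or_pos p with hp | hp
  · simp only [Experiment.measureReal_Jhat_eq_one_of_p_eq_zero hp]
    exact tendsto_const_nhds
  have hσ' : (0 : ℝ) < σ := by exact_mod_cast hσ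
  have hp' : (0 : ℝ) < p := by exact_mod_cast hp
  have hN' : (0 : ℝ) < N := by exact_mod_cast hN
  have hs0 : 0 < √(N : ℝ) := Real.sqrt_pos.2 hN'
  have hNs : (N : ℝ) = √(N : ℝ) * √(N : ℝ) := (Real.mul_self_sqrt hN'.le).symm
  set δ := min α (1 - α) with hδ
  have hδ0 : 0 < δ := lt_min hα (by linarith)
  set a := max α (1 - α) with ha
  have haδ : a = 1 - δ := by
    have := min_add_max α (1 - α)
    linarith
  have ha1 : a < 1 := by linarith
  have ha2 : 1 / 2 ≤ a := half_le_max_one_sub α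
  set q := lam / (4 * σ) * √(N : ℝ) - 1 with hq
  have hfac : lam * N / (4 * σ) - √(N : ℝ) = √(N : ℝ) * q := by
    nth_rewrite 1 [hNs]
    rw [hq]
    ring
  have hqs : √(2 * Real.log (p / δ)) < q := by rw [hq]; linarith
  have hq0 : 0 < q := (Real.sqrt_nonneg _).trans_lt hqs
  have hR : √(N : ℝ) < lam * N / (4 * σ) := by
    have := mul_pos hs0 hq0
    linarith
  have hexp : -(lam * N / (4 * σ) - √(N : ℝ)) ^ 2 / (2 * N) = -(q ^ 2 / 2) := by
    rw [hfac, mul_pow, Real.sq_sqrt hN'.le]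
    field_simp
  set v := 1 - p * Real.exp (-(q ^ 2 / 2)) with hv
  have hv1 : v ≤ 1 := by
    have : 0 < p * Real.exp (-(q ^ 2 / 2)) := by positivity
    linarith
  -- The sample size condition says exactly that the failure bound `p * exp (-q² / 2)` is below `min
  -- α (1 - α) = 1 - a`.
  have hav : a < v := by
    have h1 : Real.log (p / δ) < q ^ 2 / 2 := by
      have := (Real.sqrt_lt' hq0).1 hqs
      linarith
    have h2 : p / δ < Real.exp (q ^ 2 / 2) := (Real.log_lt_iff_lt_exp (by positivity)).1 h1
    have h3 : p * Real.exp (-(q ^ 2 / 2)) < δ := by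
      rw [Real.exp_neg, ← div_eq_mul_inv, div_lt_iff₀ (Real.exp_pos _)]
      rw [div_lt_iff₀ hδ0] at h2
      linarith
    linarith
  have hrate : 0 < (v - a) ^ 2 / (2 * a * (1 - a)) := by
    have : 0 < v - a := by linarith
    have : 0 < 1 - a := by linarith
    positivity
  have hlim : Tendsto (fun m : ℕ => 1 - Real.exp (-m * ((v - a) ^ 2 / (2 * a * (1 - a)))))
      atTop (𝓝 1) := by
    have h1 := Real.tendsto_exp_neg_atTop_nhds_zero.comp
      ((tendsto_natCast_atTop_atTop (R := ℝ)).atTop_mul_const hrate)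
    simpa [Function.comp_def] using h1.const_sub 1
  refine tendsto_of_tendsto_of_tendsto_of_le_of_le' hlim tendsto_const_nhds ?_
    (Eventually.of_forall fun m => measureReal_le_one)
  filter_upwards [hE] with m hEm
  have hmean : m * v ≤ ∑ s, μ.real ((E m).noiseEvent φ lam s) := by
    calc m * v = ∑ _s : Fin m, v := by simp
      _ ≤ _ := Finset.sum_le_sum fun s _ =>
        (by rw [hv, ← hexp]; exact hEm.one_sub_le_measureReal_noiseEvent hφ hσ s hR)
  exact (one_sub_exp_sq_le_measureReal_lt_card hEm.measurableSet_noiseEvent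
    hEm.iIndepFun_indicator_noiseEvent ha2 hav hv1 hmean).trans
    (measureReal_mono fun w hw => hEm.Jhat_eq hlam hcκ hthrBar hlam' (fun _ => hN) hw)

end FedKGL

open FedKGL in
theorem mainTheorem7 {𝒳 Ω : Type*} [MeasurableSpace Ω] (μ : Measure Ω) [IsProbabilityMeasure μ]
    {p : ℕ} {d : Fin p → ℕ} (φ : FeatureMaps 𝒳 d)
    (hφ : ∀ j x x', baseKernel φ j x x' ≤ 1)
    (Jstar : Finset (Fin p)) (σ : ℝ≥0) (hσ : 0 < σ)
    (c₁ cκ thr thrBar α : ℝ) (hcκ : 0 < cκ) (hthr : 0 < thr) (hthr' : thr < c₁)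
    (hthrBar : thrBar = min thr (c₁ - thr)) (hα : 0 < α) (hα' : α < 1) :
    -- the quantitative bound, for arbitrary sample sizes
    (∀ (m : ℕ) (n : Fin m → ℕ) (lam : ℝ) (E : Experiment 𝒳 Ω d m n) (a v : ℝ),
      E.Assumptions μ φ Jstar σ c₁ cκ lam →
      lam ≤ thrBar * cκ ^ 2 / 8 →
      (∀ s j, √(groupGram φ (E.x s) j).trace < lam * n s / (4 * σ)) →
      a = max α (1 - α) →
      v = (1 / (m : ℝ)) * ∑ s, clientLevel φ lam σ (E.x s) →
      a < v →
      1 - Real.exp (-m * bernoulliKL a v) ≤ μ.real {w | E.Jhat thr α w = Jstar} ∧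
      1 - Real.exp (-m * ((v - a) ^ 2 / (2 * a * (1 - a)))) ≤
        μ.real {w | E.Jhat thr α w = Jstar}) ∧
    -- consistency as the common sample size grows, for a fixed number of clients
    (∀ (m : ℕ), 0 < m → ∀ E : (N : ℕ) → Experiment 𝒳 Ω d m (fun _ => N),
      (∀ᶠ N in atTop, (E N).Assumptions μ φ Jstar σ c₁ cκ (thrBar * cκ ^ 2 / 8)) →
      Tendsto (fun N => μ.real {w | (E N).Jhat thr α w = Jstar}) atTop (𝓝 1)) ∧
    -- consistency as the number of clients grows, for a fixed, large enough sample size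
    (∀ (N : ℕ), 0 < N →
      (√(2 * Real.log (p / min α (1 - α))) + 1) * (32 * σ) / (√(N : ℝ) * cκ ^ 2) < thrBar →
      ∀ E : (m : ℕ) → Experiment 𝒳 Ω d m (fun _ => N),
      (∀ᶠ m in atTop, (E m).Assumptions μ φ Jstar σ c₁ cκ (thrBar * cκ ^ 2 / 8)) →
      Tendsto (fun m => μ.real {w | (E m).Jhat thr α w = Jstar}) atTop (𝓝 1)) := by
  have hbar : 0 < thrBar := hthrBar ▸ lt_min hthr (by linarith)
  have hlam : 0 < thrBar * cκ ^ 2 / 8 := by positivity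
  have hσ' : (0 : ℝ) < σ := by exact_mod_cast hσ
  refine ⟨fun m n lam E a v hE hlam' hR ha hv hav =>
      quantitative_bound hσ hcκ hthrBar hα hα' hE hlam' hR ha hv hav,
    fun m hm E hE => tendsto_measureReal_Jhat_sampleSize hφ hσ hcκ hthrBar hα hα' hlam le_rfl hm E
      hE,
    fun N hN hlarge E hE => tendsto_measureReal_Jhat_clients hφ hσ hcκ hthrBar hα hα' hlam le_rfl
      hN ?_ E hE⟩
  have hN' : (0 : ℝ) < N := by exact_mod_cast hN
  have hs0 : 0 < √(N : ℝ) := Real.sqrt_pos.2 hN'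
  rw [div_lt_iff₀ (by positivity)] at hlarge
  -- The constant `32` is the `8` from the choice of `lam` times the `4` from the noise level.
  have h1 : thrBar * cκ ^ 2 / 8 / (4 * σ) * √(N : ℝ) =
      thrBar * (√(N : ℝ) * cκ ^ 2) / (32 * σ) := by
    field_simp
    ring
  rw [h1, lt_div_iff₀ (by positivity)]
  exact hlarge
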